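/- All graphs are simple and undirected. An infinite graph $G$ is *non-amenable* if there is a constant $\gamma>0$ such that $|\partial S|\ge \gamma |S|$ for every finite vertex set $S$, where $\partial S$ is the set of vertices outside $S$ that are adjacent to a vertex of $S$. A *planar map* is a graph $G$ together with an embedding in the plane: distinct vertices are distinct points, edges are arcs between their endvertices, and an arc meets vertices and other arcs only at common endvertices. For a locally finite planar map $G$, the *roundabout graph* $\mathring{G}$ has as vertices the pairs $(v,e)$ with $e$ an edge of $G$ and $v$ an endvertex of $e$. Its edges are as follows: $(v,e)$ is joined to $(w,e)$ for each edge $e=vw$ of $G$, and $(v,e)$ is joined to $(v,f)$ whenever $e\neq f$ are adjacent in the cyclic order that the embedding induces on the edges incident with $v$. A locally finite graph is *transient* if, for every vertex $o$, simple random walk started at $o$ returns to $o$ with probability strictly less than $1$. The planar map $G$ is *UK-transient* if $\mathring{G}$ is transient. **Theorem.** Every locally finite non-amenable planar map is UK-transient. -/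

import Mathlib

open MeasureTheory ProbabilityTheory

noncomputable section

/-! ### Amenability -/

/-- The outer vertex boundary of a vertex set `S`: the vertices outside `S` that are adjacent to a
vertex of `S`. -/
def SimpleGraph.vertexBoundary {V : Type*} (G : SimpleGraph V) (S : Set V) : Set V :=
  {w | w ∉ S ∧ ∃ v ∈ S, G.Adj v w}

/-- An infinite (locally finite) graph is non-amenable if some constant `γ > 0` satisfies
`|∂S| ≥ γ |S|` for every finite set `S` of vertices. -/
def SimpleGraph.IsNonamenable {V : Type*} (G : SimpleGraph V) : Prop :=
  Infinite V ∧
    ∃ γ : ℝ, 0 < γ ∧ ∀ S : Finset V, γ * (S.card : ℝ) ≤ ((G.vertexBoundary ↑S).ncard : ℝ)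

/-! ### Simple random walk and transience -/

open Classical in
/-- The law of one step of simple random walk from `x`: uniform on the neighbours of `x`.
(If `x` has no neighbour, the walk stays at `x`; the same junk value is used
if `x` has infinitely many neighbours.) -/
def SimpleGraph.stepMeasure {V : Type*} [MeasurableSpace V] (G : SimpleGraph V) (x : V) :
    Measure V :=
  if (G.neighborSet x).Finite ∧ (G.neighborSet x).Nonempty then uniformOn (G.neighborSet x)
  else Measure.dirac x

/-- The transition kernel of simple random walk, as a function of the past trajectory
(of which it only uses the current position). -/
def SimpleGraph.stepKernel {V : Type*} [MeasurableSpace V] [DiscreteMeasurableSpace V]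
    (G : SimpleGraph V) (n : ℕ) : Kernel (Finset.Iic n → V) V where
  toFun x := G.stepMeasure (x ⟨n, Finset.mem_Iic.2 le_rfl⟩)
  measurable' := (Measurable.of_discrete (f := G.stepMeasure)).comp (measurable_pi_apply _)

instance SimpleGraph.stepKernel.instIsMarkovKernel {V : Type*} [MeasurableSpace V]
    [DiscreteMeasurableSpace V] (G : SimpleGraph V) (n : ℕ) : IsMarkovKernel (G.stepKernel n) := by
  refine ⟨fun x => ?_⟩
  change IsProbabilityMeasure (G.stepMeasure _)
  unfold SimpleGraph.stepMeasure
  split_ifs with h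
  · exact isProbabilityMeasure_uniformOn h.1 h.2
  · infer_instance

/-- The law, on the space of trajectories `ℕ → V`, of simple random walk started at `o`. -/
def SimpleGraph.walkLaw {V : Type*} [MeasurableSpace V] [DiscreteMeasurableSpace V]
    (G : SimpleGraph V) (o : V) : Measure (ℕ → V) :=
  Kernel.trajMeasure (X := fun _ => V) (Measure.dirac o) G.stepKernel

/-- The probability that simple random walk started at `o` ever returns to `o`. Vertex sets are
given the discrete `σ`-algebra. -/
def SimpleGraph.returnProb {V : Type*} (G : SimpleGraph V) (o : V) : ENNReal :=
  letI : MeasurableSpace V := ⊤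
  haveI : DiscreteMeasurableSpace V := ⟨fun _ => trivial⟩
  G.walkLaw o {ω | ∃ n, 1 ≤ n ∧ ω n = o}

/-- A locally finite graph is transient if simple random walk started at any given vertex
returns to it with probability less than one. (For connected graphs it does not matter which
vertex is considered; for disconnected ones all components are required to be transient.) -/
def SimpleGraph.IsTransient {V : Type*} (G : SimpleGraph V) : Prop :=
  ∀ o : V, G.returnProb o < 1

/-! ### Planar maps -/

/-- A planar map (plane graph): a simple graph drawn in the plane `ℂ`. Vertices are distinct
points, each edge `uv` is an arc (injective path) joining `u` to `v`, and arcs meet vertices and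
other arcs only at common endpoints. The drawing is allowed to have accumulation points. -/
structure PlanarMap (V : Type*) where
  /-- the underlying graph -/
  graph : SimpleGraph V
  /-- the position of a vertex -/
  pt : V → ℂ
  /-- the arc of an edge, parametrised from `u` to `v` -/
  arc : ∀ u v : V, graph.Adj u v → Path (pt u) (pt v)
  pt_injective : Function.Injective pt
  /-- the two orientations of an edge have the same arc, traversed in opposite directions -/
  arc_symm : ∀ (u v : V) (h : graph.Adj u v), arc v u h.symm = (arc u v h).symm
  arc_injective : ∀ (u v : V) (h : graph.Adj u v), Function.Injective (arc u v h)
  /-- an arc contains no vertices other than its endpoints -/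
  arc_vertex : ∀ (u v : V) (h : graph.Adj u v) (t : unitInterval) (w : V),
    arc u v h t = pt w → w = u ∨ w = v
  /-- arcs of distinct edges meet only in vertices -/
  arc_disjoint : ∀ (u v : V) (h : graph.Adj u v) (u' v' : V) (h' : graph.Adj u' v')
    (t t' : unitInterval), s(u, v) ≠ s(u', v') →
      arc u v h t = arc u' v' h' t' → ∃ w, arc u v h t = pt w

namespace PlanarMap

variable {V : Type*} (G : PlanarMap V)

/-- Half the distance from `v` to its nearest neighbour in the drawing. If `v` has finitely many
neighbours, but at least one, then this is positive. -/
def radius (v : V) : ℝ := Metric.infDist (G.pt v) (G.pt '' G.graph.neighborSet v) / 2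

/-- The first time at which the arc of the dart `d = (v, w)`, started at `v`, hits the circle of
radius `G.radius v` around `v`. -/
def exitTime (d : G.graph.Dart) : unitInterval :=
  sInf {t | G.radius d.fst ≤ dist (G.arc d.fst d.snd d.adj t) (G.pt d.fst)}

/-- The direction, seen from `v`, of the point where the arc of the dart `d = (v, w)` first hits
the circle of radius `G.radius v` around `v`. -/
def exitAngle (d : G.graph.Dart) : Real.Angle :=
  ((G.arc d.fst d.snd d.adj (G.exitTime d) - G.pt d.fst).arg : Real.Angle)

/-- `d'` directly follows `d` in the cyclic order induced by the drawing on the edges at their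
common start vertex `v`: no third edge at `v` lies strictly between them (counterclockwise).
The cyclic order is that of the points in which the arcs starting at `v` first hit a circle around
`v` that is small enough not to enclose the other endpoints; up to those points, the arcs are
disjoint paths in a closed disc from the centre to distinct points of the bounding circle,
so the order does not depend on the radius of the circle. -/
def IsNextAt (d d' : G.graph.Dart) : Prop :=
  d.fst = d'.fst ∧ d ≠ d' ∧
    ∀ d'' : G.graph.Dart, d''.fst = d.fst → ¬ sbtw (G.exitAngle d) (G.exitAngle d'') (G.exitAngle d')

/-- The roundabout graph. Its vertices are the pairs `(v, e)` with `e` an edge and `v` an endvertex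
of `e`; as the graph is simple, such a pair is the same as a dart, namely `e` directed away
from `v`. For each edge `e = vw`, the vertices `(v, e)` and `(w, e)` are joined, and
`(v, e)` and `(v, f)` are joined if `e` and `f` are adjacent in the cyclic order at `v`. -/
def roundabout : SimpleGraph G.graph.Dart where
  Adj d d' := d' = d.symm ∨ G.IsNextAt d d' ∨ G.IsNextAt d' d
  symm := ⟨by
    rintro d d' (h | h | h)
    · exact Or.inl (by rw [h, SimpleGraph.Dart.symm_symm])
    · exact Or.inr (Or.inr h)
    · exact Or.inr (Or.inl h)⟩
  loopless := ⟨by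
    rintro d (h | h | h)
    · exact d.symm_ne h.symm
    · exact h.2.1 rfl
    · exact h.2.1 rfl⟩

/-- A planar map is UK-transient if its roundabout graph is transient. -/
def IsUKTransient : Prop := G.roundabout.IsTransient

end PlanarMap

end

/-!
On an arc that avoids the point `p`, the function `z ↦ z - p` has a continuous logarithm. For two
disjoint edges `uu'` and `ww'` of a planar map with arcs `α` and `β`, lifting `α s - β t` on the
square shows that the increments of the logarithm along the four sides cancel. Comparison with the
principal logarithms of the differences of the vertices turns this into an identity between
integers, which survives the contraction of edges and fails in `K₅` for a reason of parity. As
dense graphs contract to graphs that contain `K₅`, a finite set of vertices of a planar map spans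
only linearly many edges.

Let `D` be a finite set of darts, with inner boundary `∂D` in the roundabout graph. A vertex with
some but not all of its darts in `D` has a dart in `∂D`, and so does an edge with exactly one of its
darts in `D`. Hence the set of vertices with all darts in `D` has at most `2|∂D|` outer neighbours,
and by non-amenability `O(|∂D|)` elements. Any other dart in `D` than those counted in `∂D` belongs
to an edge between the `O(|∂D|)` vertices with a dart in `D`, so the edge bound gives
`|D| = O(|∂D|)`. This isoperimetric inequality implies a Poincaré inequality which, applied to the
Green function of the walk killed on its return, bounds the return probability away from `1`.
-/

noncomputable section

/-! ### Increments of the logarithm -/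

theorem exists_continuous_log {X : Type*} [TopologicalSpace X] [SimplyConnectedSpace X]
    [LocallyPathConnectedSpace X] {g : X → ℂ} (hg : Continuous g) (h0 : ∀ x, g x ≠ 0) :
    ∃ f : X → ℂ, Continuous f ∧ ∀ x, Complex.exp (f x) = g x := by
  obtain ⟨x₀⟩ : Nonempty X := inferInstance
  obtain ⟨F, ⟨-, hF⟩, -⟩ := Complex.isCoveringMapOn_exp.existsUnique_continuousMap_lifts
    ⟨g, hg⟩ (a₀ := x₀) (Complex.exp_log (h0 x₀)) h0
  exact ⟨F, F.continuous, congrFun hF⟩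

theorem continuous_log_sub_eq {X : Type*} [TopologicalSpace X] [PreconnectedSpace X]
    {f g : X → ℂ} (hf : Continuous f) (hg : Continuous g)
    (h : ∀ x, Complex.exp (f x) = Complex.exp (g x)) (x y : X) :
    f y - f x = g y - g x := by
  have key : f = fun z => g z + (f x - g x) := by
    refine Complex.isCoveringMap_exp.eq_of_comp_eq hf (by fun_prop) ?_ x (by ring)
    funext z
    simp [Complex.exp_add, Complex.exp_sub, h]
  rw [key]
  ring

open Classical in
/-- The increment over `[0, 1]` of a continuous logarithm of `g`; the junk value is `0` if `g` has
no continuous logarithm. The domain is `ℝ` rather than `[0, 1]` so that the theory of covering maps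
applies to it. -/
def logIncrement (g : ℝ → ℂ) : ℂ :=
  if h : ∃ l : ℝ → ℂ, Continuous l ∧ ∀ t, Complex.exp (l t) = g t
  then h.choose 1 - h.choose 0 else 0

theorem logIncrement_eq {g l : ℝ → ℂ} (hl : Continuous l) (h : ∀ t, Complex.exp (l t) = g t) :
    logIncrement g = l 1 - l 0 := by
  have hex : ∃ l : ℝ → ℂ, Continuous l ∧ ∀ t, Complex.exp (l t) = g t := ⟨l, hl, h⟩
  rw [logIncrement, dif_pos hex]
  exact continuous_log_sub_eq hex.choose_spec.1 hl
    (fun t => (hex.choose_spec.2 t).trans (h t).symm) 0 1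

theorem exp_logIncrement_mul {g : ℝ → ℂ} (hg : Continuous g) (h0 : ∀ t, g t ≠ 0) :
    Complex.exp (logIncrement g) * g 0 = g 1 := by
  obtain ⟨l, hl, h⟩ := exists_continuous_log hg h0
  rw [logIncrement_eq hl h, ← h, ← h, ← Complex.exp_add, sub_add_cancel]

theorem logIncrement_neg {g : ℝ → ℂ} (hg : Continuous g) (h0 : ∀ t, g t ≠ 0) :
    logIncrement (fun t => -g t) = logIncrement g := by
  obtain ⟨l, hl, h⟩ := exists_continuous_log hg h0
  rw [logIncrement_eq hl h, logIncrement_eq (l := fun t => l t + Real.pi * Complex.I)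
    (by fun_prop) (fun t => by simp [Complex.exp_add, h])]
  ring

theorem logIncrement_square {g : ℝ × ℝ → ℂ} (hg : Continuous g) (h0 : ∀ q, g q ≠ 0) :
    logIncrement (fun t => g (1, t)) - logIncrement (fun t => g (0, t)) =
      logIncrement (fun s => g (s, 1)) - logIncrement (fun s => g (s, 0)) := by
  obtain ⟨l, hl, h⟩ := exists_continuous_log hg h0
  rw [logIncrement_eq (l := fun t => l (1, t)) (by fun_prop) (fun t => h _),
    logIncrement_eq (l := fun t => l (0, t)) (by fun_prop) (fun t => h _),
    logIncrement_eq (l := fun s => l (s, 1)) (by fun_prop) (fun t => h _),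
    logIncrement_eq (l := fun s => l (s, 0)) (by fun_prop) (fun t => h _)]
  ring

theorem exists_log_neg_eq {z : ℂ} (hz : z ≠ 0) :
    ∃ k : ℤ, Complex.log (-z) = Complex.log z + (2 * k + 1) * (Real.pi * Complex.I) := by
  have h : Complex.exp (Complex.log (-z)) = Complex.exp (Complex.log z + Real.pi * Complex.I) := by
    rw [Complex.exp_add, Complex.exp_log hz, Complex.exp_log (neg_ne_zero.2 hz),
      Complex.exp_pi_mul_I, mul_neg_one]
  obtain ⟨k, hk⟩ := Complex.exp_eq_exp_iff_exists_int.1 h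
  exact ⟨k, by rw [hk]; ring⟩

theorem exists_logIncrement_eq {g : ℝ → ℂ} (hg : Continuous g) (h0 : ∀ t, g t ≠ 0) :
    ∃ k : ℤ, logIncrement g =
      Complex.log (g 1) - Complex.log (g 0) + 2 * k * (Real.pi * Complex.I) := by
  have h : Complex.exp (logIncrement g) = Complex.exp (Complex.log (g 1) - Complex.log (g 0)) := by
    rw [Complex.exp_sub, Complex.exp_log (h0 1), Complex.exp_log (h0 0), eq_div_iff (h0 0),
      exp_logIncrement_mul hg h0]
  obtain ⟨k, hk⟩ := Complex.exp_eq_exp_iff_exists_int.1 h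
  exact ⟨k, by rw [hk]; ring⟩

/-! ### Crossing cochains -/

/-- The algebraic trace left by a drawing of `H`. In a drawing, `τ u w w'` is the signed number of
times the arc from `w` to `w'` crosses the branch cut of the logarithm centred at `u`, and `κ u w`
compares the logarithms centred at `u` and at `w` of the segment between these two points. The
identity says that the arcs of two disjoint edges `uu'` and `ww'` do not meet. -/
def IsCrossingCochain {V : Type*} (κ : V → V → ℤ) (H : SimpleGraph V) (τ : V → V → V → ℤ) : Prop :=
  ∀ ⦃u u' w w'⦄, H.Adj u u' → H.Adj w w' → u ≠ w → u ≠ w' → u' ≠ w → u' ≠ w' →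
    τ u' w w' - τ u w w' - (τ w' u u' - τ w u u') = κ u' w' - κ u w' - (κ u' w - κ u w)

namespace IsCrossingCochain

variable {V : Type*} {κ : V → V → ℤ} {H H' : SimpleGraph V} {τ : V → V → V → ℤ}

theorem mono (h : IsCrossingCochain κ H τ) (hle : H' ≤ H) : IsCrossingCochain κ H' τ :=
  fun _ _ _ _ hu hw => h (hle hu) (hle hw)

theorem cliqueFree_five (h : IsCrossingCochain κ H τ) (hκ : ∀ u w, u ≠ w → Odd (κ u w + κ w u)) :
    H.CliqueFree 5 := by
  by_contra hcl
  obtain ⟨f⟩ := (SimpleGraph.not_cliqueFree_iff_top_isContained 5).1 hcl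
  have hf (i j : Fin 5) (hij : i ≠ j) : H.Adj (f i) (f j) := f.toHom.map_adj hij
  have square (a b c d : Fin 5) (hd : [a, b, c, d].Nodup) := by
    simp only [List.nodup_cons, List.mem_cons, List.not_mem_nil, or_false, not_or] at hd
    obtain ⟨⟨hab, hac, had⟩, ⟨hbc, hbd⟩, hcd, -⟩ := hd
    exact h (hf a b hab) (hf c d hcd) (hf a c hac).ne (hf a d had).ne (hf b c hbc).ne
      (hf b d hbd).ne
  have odd (a b : Fin 5) (hab : a ≠ b) := Int.odd_iff.1 (hκ _ _ (hf a b hab).ne)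
  -- Modulo 2, every `τ` occurs in exactly two of these fifteen identities, whereas the `κ` add up
  -- to an odd number, as do the five crossings of the diagonals of a pentagon.
  have := square 1 2 3 4 (by decide)
  have := square 1 3 2 4 (by decide)
  have := square 1 4 2 3 (by decide)
  have := square 0 2 3 4 (by decide)
  have := square 0 3 2 4 (by decide)
  have := square 0 4 2 3 (by decide)
  have := square 0 1 3 4 (by decide)
  have := square 0 3 1 4 (by decide)
  have := square 0 4 1 3 (by decide)
  have := square 0 1 2 4 (by decide)
  have := square 0 2 1 4 (by decide)
  have := square 0 4 1 2 (by decide)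
  have := square 0 1 2 3 (by decide)
  have := square 0 2 1 3 (by decide)
  have := square 0 3 1 2 (by decide)
  have := odd 0 1 (by decide)
  have := odd 0 2 (by decide)
  have := odd 0 3 (by decide)
  have := odd 0 4 (by decide)
  have := odd 1 2 (by decide)
  have := odd 1 3 (by decide)
  have := odd 1 4 (by decide)
  have := odd 2 3 (by decide)
  have := odd 2 4 (by decide)
  have := odd 3 4 (by decide)
  omega

end IsCrossingCochain

namespace PlanarMap

variable {V : Type*} (G : PlanarMap V)

theorem arc_extend_ne_pt {u w w' : V} (hw : G.graph.Adj w w') (h : u ≠ w) (h' : u ≠ w') (t : ℝ) :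
    (G.arc w w' hw).extend t ≠ G.pt u :=
  fun e => (G.arc_vertex w w' hw _ u e).elim h h'

theorem arc_extend_ne_arc_extend {u u' w w' : V} (hu : G.graph.Adj u u') (hw : G.graph.Adj w w')
    (h₁ : u ≠ w) (h₂ : u ≠ w') (h₃ : u' ≠ w) (h₄ : u' ≠ w') (s t : ℝ) :
    (G.arc w w' hw).extend t ≠ (G.arc u u' hu).extend s := by
  intro e
  obtain ⟨x, hx⟩ := G.arc_disjoint w w' hw u u' hu (Set.projIcc 0 1 zero_le_one t)
    (Set.projIcc 0 1 zero_le_one s) (by simp [h₁.symm, h₃.symm]) e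
  have hx' : (G.arc u u' hu).extend s = G.pt x := e.symm.trans hx
  by_cases h : x = u ∨ x = u'
  · rcases h with rfl | rfl
    exacts [G.arc_extend_ne_pt hw h₁ h₂ t hx, G.arc_extend_ne_pt hw h₃ h₄ t hx]
  · rw [not_or] at h
    exact G.arc_extend_ne_pt hu h.1 h.2 s hx'

theorem logIncrement_arc_sub_arc {u u' w w' : V} (hu : G.graph.Adj u u') (hw : G.graph.Adj w w')
    (h₁ : u ≠ w) (h₂ : u ≠ w') (h₃ : u' ≠ w) (h₄ : u' ≠ w') :
    logIncrement (fun t => (G.arc w w' hw).extend t - G.pt u') -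
        logIncrement (fun t => (G.arc w w' hw).extend t - G.pt u) =
      logIncrement (fun t => (G.arc u u' hu).extend t - G.pt w') -
        logIncrement (fun t => (G.arc u u' hu).extend t - G.pt w) := by
  have key := logIncrement_square
    (g := fun q => (G.arc w w' hw).extend q.2 - (G.arc u u' hu).extend q.1) (by fun_prop)
    (fun q => sub_ne_zero.2 (G.arc_extend_ne_arc_extend hu hw h₁ h₂ h₃ h₄ _ _))
  simp only [Path.extend_zero, Path.extend_one] at key
  rw [key, ← logIncrement_neg (by fun_prop)
      (fun t => sub_ne_zero.2 (G.arc_extend_ne_pt hu h₂.symm h₄.symm t)),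
    ← logIncrement_neg (by fun_prop)
      (fun t => sub_ne_zero.2 (G.arc_extend_ne_pt hu h₁.symm h₃.symm t))]
  simp only [neg_sub]

theorem exists_isCrossingCochain :
    ∃ κ τ, IsCrossingCochain κ G.graph τ ∧ ∀ u w, u ≠ w → Odd (κ u w + κ w u) := by
  have hκ : ∀ u w, ∃ k : ℤ, u ≠ w → Complex.log (G.pt u - G.pt w) = Complex.log (G.pt w - G.pt u) +
      (2 * k + 1) * (Real.pi * Complex.I) := by
    intro u w
    by_cases h : u = w
    · exact ⟨0, fun h' => absurd h h'⟩
    · obtain ⟨k, hk⟩ := exists_log_neg_eq (sub_ne_zero.2 (G.pt_injective.ne (Ne.symm h)))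
      exact ⟨k, fun _ => by rw [← hk, neg_sub]⟩
  have hτ : ∀ u w w', ∃ k : ℤ, ∀ hw : G.graph.Adj w w', u ≠ w → u ≠ w' →
      logIncrement (fun t => (G.arc w w' hw).extend t - G.pt u) =
        Complex.log (G.pt w' - G.pt u) - Complex.log (G.pt w - G.pt u) +
          2 * k * (Real.pi * Complex.I) := by
    intro u w w'
    by_cases h : G.graph.Adj w w' ∧ u ≠ w ∧ u ≠ w'
    · obtain ⟨k, hk⟩ := exists_logIncrement_eq
        (g := fun t => (G.arc w w' h.1).extend t - G.pt u) (by fun_prop)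
        (fun t => sub_ne_zero.2 (G.arc_extend_ne_pt h.1 h.2.1 h.2.2 t))
      exact ⟨k, fun _ _ _ => by simpa using hk⟩
    · exact ⟨0, fun h₁ h₂ h₃ => absurd ⟨h₁, h₂, h₃⟩ h⟩
  choose κ hκ using hκ
  choose τ hτ using hτ
  have hpi : (Real.pi * Complex.I : ℂ) ≠ 0 := by simp [Real.pi_ne_zero]
  refine ⟨κ, τ, fun u u' w w' hu hw h₁ h₂ h₃ h₄ => ?_, fun u w h => ?_⟩
  · have e := G.logIncrement_arc_sub_arc hu hw h₁ h₂ h₃ h₄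
    rw [hτ u' w w' hw h₃ h₄, hτ u w w' hw h₁ h₂, hτ w' u u' hu h₂.symm h₄.symm,
      hτ w u u' hu h₁.symm h₃.symm, hκ u' w' h₄, hκ u w' h₂, hκ u' w h₃, hκ u w h₁] at e
    have e' : ((τ u' w w' - τ u w w' - (τ w' u u' - τ w u u') : ℤ) : ℂ) * (Real.pi * Complex.I) =
        ((κ u' w' - κ u w' - (κ u' w - κ u w) : ℤ) : ℂ) * (Real.pi * Complex.I) := by
      push_cast
      linear_combination e / 2
    exact_mod_cast mul_right_cancel₀ hpi e'
  · have e : (κ u w + κ w u + 1 : ℂ) * (Real.pi * Complex.I) = 0 := by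
      linear_combination (hκ u w h + hκ w u h.symm) / (-2)
    have : κ u w + κ w u + 1 = 0 := by exact_mod_cast (mul_eq_zero.1 e).resolve_right hpi
    exact ⟨-1, by lia⟩

end PlanarMap

/-! ### Dense graphs have large clique minors -/

section Contraction

open Finset

variable {V : Type*} {G H : SimpleGraph V} {x y : V} {Q : SimpleGraph V → Prop}

open Classical in
/-- The contraction of the edge `xy` into its endvertex `x`. The type of vertices remains the same:
`y` becomes an isolated vertex. -/
def contractInto (G : SimpleGraph V) (x y : V) : SimpleGraph V :=
  G.map (Function.update id y x)

theorem contractInto_mono (h : G ≤ H) (x y : V) : contractInto G x y ≤ contractInto H x y :=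
  SimpleGraph.map_monotone _ h

open Classical in
theorem contractInto_adj (hxy : x ≠ y) {a b : V} :
    (contractInto G x y).Adj a b ↔ a ≠ b ∧ a ≠ y ∧ b ≠ y ∧
      (G.Adj a b ∨ a = x ∧ G.Adj y b ∨ b = x ∧ G.Adj y a) := by
  have image_ne (c : V) : Function.update id y x c ≠ y := by
    by_cases h : c = y <;> simp [h, hxy]
  have image_of_ne {c : V} (h : c ≠ y) : Function.update id y x c = c := by simp [h]
  simp only [contractInto, SimpleGraph.map_adj']
  constructor
  · rintro ⟨hab, c, d, hcd, rfl, rfl⟩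
    refine ⟨hab, image_ne c, image_ne d, ?_⟩
    by_cases hc : c = y <;> by_cases hd : d = y
    · exact absurd (hc.trans hd.symm) hcd.ne
    · subst hc
      simp [hd, hcd]
    · subst hd
      simp [hc, hcd.symm]
    · simp [hc, hd, hcd]
  · rintro ⟨hab, ha, hb, h | ⟨rfl, h⟩ | ⟨rfl, h⟩⟩
    · exact ⟨hab, a, b, h, image_of_ne ha, image_of_ne hb⟩
    · exact ⟨hab, y, b, h, by simp, image_of_ne hb⟩
    · exact ⟨hab, a, y, h.symm, image_of_ne ha, by simp⟩

theorem support_contractInto_subset (h : G.Adj x y) :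
    (contractInto G x y).support ⊆ G.support \ {y} := by
  intro a ⟨b, hab⟩
  obtain ⟨-, ha, -, hab | ⟨rfl, -⟩ | ⟨-, hya⟩⟩ := (contractInto_adj h.ne).1 hab
  exacts [⟨⟨b, hab⟩, ha⟩, ⟨⟨y, h⟩, ha⟩, ⟨⟨y, hya.symm⟩, ha⟩]

theorem card_interedges_eq_sum (G : SimpleGraph V) [DecidableRel G.Adj] (s t : Finset V) :
    #(G.interedges s t) = ∑ a ∈ s, #{b ∈ t | G.Adj a b} := by
  simp only [SimpleGraph.interedges_def, card_filter, sum_product]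

theorem ne_bot_of_card_interedges_pos [DecidableRel G.Adj] {s t : Finset V}
    (h : 0 < #(G.interedges s t)) : G ≠ ⊥ := by
  obtain ⟨⟨a, b⟩, hab⟩ := card_pos.1 h
  exact SimpleGraph.ne_bot_iff_exists_adj.2 ⟨a, b, (G.mk_mem_interedges_iff.1 hab).2.2⟩

theorem card_interedges_insert [DecidableEq V] (G : SimpleGraph V) [DecidableRel G.Adj]
    {s : Finset V} (hy : y ∉ s) :
    #(G.interedges (insert y s) (insert y s)) =
      #(G.interedges s s) + 2 * #{b ∈ s | G.Adj y b} := by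
  simp only [card_interedges_eq_sum, card_filter, sum_insert hy, sum_add_distrib,
    SimpleGraph.irrefl, if_false, G.adj_comm _ y]
  ring

open Classical in
theorem card_interedges_contractInto (hxy : G.Adj x y) {W : Finset V} (hx : x ∈ W) (hy : y ∈ W) :
    #(G.interedges W W) = #((contractInto G x y).interedges (W.erase y) (W.erase y)) + 2 +
      2 * #{b ∈ W | G.Adj x b ∧ G.Adj y b} := by
  set U := (W.erase y).erase x
  have hxU : x ∉ U := notMem_erase _ _
  have hyU : y ∉ insert x U := by simp [U, hxy.ne']
  have hU : W.erase y = insert x U := (insert_erase (mem_erase.2 ⟨hxy.ne, hx⟩)).symm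
  have hW : W = insert y (insert x U) := by rw [← hU, insert_erase hy]
  have outside : #((contractInto G x y).interedges U U) = #(G.interedges U U) := by
    congr 1
    ext ⟨a, b⟩
    simp only [SimpleGraph.mk_mem_interedges_iff, contractInto_adj hxy.ne, U, mem_erase]
    grind [SimpleGraph.irrefl]
  have merged : {b ∈ U | (contractInto G x y).Adj x b} = {b ∈ U | G.Adj x b ∨ G.Adj y b} := by
    refine filter_congr fun b hb => ?_
    simp only [contractInto_adj hxy.ne, U, mem_erase] at hb ⊢
    grind [SimpleGraph.ne_of_adj]
  have common : {b ∈ W | G.Adj x b ∧ G.Adj y b} = {b ∈ U | G.Adj x b ∧ G.Adj y b} := by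
    ext b
    simp only [U, mem_filter, mem_erase]
    grind [SimpleGraph.ne_of_adj]
  have inclusion_exclusion := card_union_add_card_inter {b ∈ U | G.Adj x b} {b ∈ U | G.Adj y b}
  rw [← filter_or, ← filter_and] at inclusion_exclusion
  rw [common, hU, hW, card_interedges_insert G hyU, card_interedges_insert G hxU,
    card_interedges_insert _ hxU, outside, merged, filter_insert, if_pos hxy.symm,
    card_insert_of_notMem (by simp [hxU])]
  lia

open Classical in
theorem exists_forall_adj_le_card_common (hQ : ∀ G x y, Q G → G.Adj x y → Q (contractInto G x y))
    {d : ℕ} (hd : 0 < d) {W : Finset V} (hG : Q G) (hW : W.Nonempty) (hsupp : G.support ⊆ W)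
    (hdense : 2 * d * #W ≤ #(G.interedges W W)) :
    ∃ (H : SimpleGraph V) (U : Finset V), Q H ∧ H.support ⊆ U ∧ H ≠ ⊥ ∧
      ∀ x y, H.Adj x y → d ≤ #{b ∈ U | H.Adj x b ∧ H.Adj y b} := by
  induction hn : #W generalizing G W with
  | zero => exact absurd hn hW.card_ne_zero
  | succ n ih =>
    by_cases hc : ∀ x y, G.Adj x y → d ≤ #{b ∈ W | G.Adj x b ∧ G.Adj y b}
    · have hpos : 0 < 2 * d * #W := by have := hW.card_pos; positivity
      exact ⟨G, W, hG, hsupp, ne_bot_of_card_interedges_pos (hpos.trans_le hdense), hc⟩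
    push Not at hc
    obtain ⟨x, y, hxy, hlt⟩ := hc
    have hx : x ∈ W := hsupp ⟨y, hxy⟩
    have hy : y ∈ W := hsupp ⟨x, hxy.symm⟩
    have hcard : #(W.erase y) = n := by rw [card_erase_of_mem hy, hn, Nat.add_sub_cancel]
    refine ih (hQ G x y hG hxy) ⟨x, mem_erase.2 ⟨hxy.ne, hx⟩⟩ ?_ ?_ hcard
    · rw [coe_erase]
      exact (support_contractInto_subset hxy).trans (Set.sdiff_subset_sdiff_left hsupp)
    · rw [card_interedges_contractInto hxy hx hy, hn, mul_add] at hdense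
      rw [hcard]
      lia

/-- `H` is a subgraph of the link of the vertex `x`, that is, of the graph induced on the
neighbours of `x`, in some graph of the class `Q`. -/
def IsSublink (Q : SimpleGraph V → Prop) (x : V) (H : SimpleGraph V) : Prop :=
  ∃ M, Q M ∧ H ≤ M ∧ H.support ⊆ M.neighborSet x

theorem IsSublink.contractInto (hQ : ∀ G x y, Q G → G.Adj x y → Q (contractInto G x y)) {z : V}
    (h : IsSublink Q z H) (hxy : H.Adj x y) : IsSublink Q z (contractInto H x y) := by
  obtain ⟨M, hM, hle, hsupp⟩ := h
  refine ⟨_, hQ M x y hM (hle hxy), contractInto_mono hle x y, fun a ha => ?_⟩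
  obtain ⟨haH, hay⟩ := support_contractInto_subset hxy ha
  have hza : M.Adj z a := hsupp haH
  have hzy : M.Adj z y := hsupp ⟨x, hxy.symm⟩
  exact (contractInto_adj hxy.ne).2 ⟨hza.ne, hzy.ne, hay, Or.inl hza⟩

open Classical in
theorem IsSublink.exists_not_cliqueFree {z : V} (h : IsSublink Q z H) {n : ℕ} (hn : 2 ≤ n)
    (hH : ¬ H.CliqueFree n) : ∃ M, Q M ∧ ¬ M.CliqueFree (n + 1) := by
  obtain ⟨M, hM, hle, hsupp⟩ := h
  simp only [SimpleGraph.CliqueFree, not_forall, not_not] at hH ⊢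
  obtain ⟨T, hT⟩ := hH
  refine ⟨M, hM, insert z T, (hT.mono hle).insert fun b hb => ?_⟩
  obtain ⟨c, hc, hcb⟩ := exists_mem_ne (hT.card_eq ▸ hn) b
  exact hsupp ⟨c, hT.isClique hb hc hcb.symm⟩

open Classical in
theorem exists_isSublink_dense {d : ℕ} {U : Finset V} (hH : Q H) (hsupp : H.support ⊆ U)
    (hcommon : ∀ x y, H.Adj x y → d ≤ #{b ∈ U | H.Adj x b ∧ H.Adj y b}) (x : V) :
    ∃ L, IsSublink Q x L ∧ L.support ⊆ ({b ∈ U | H.Adj x b} : Finset V) ∧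
      d * #{b ∈ U | H.Adj x b} ≤ #(L.interedges {b ∈ U | H.Adj x b} {b ∈ U | H.Adj x b}) := by
  let L : SimpleGraph V := (H.induce (H.neighborSet x)).spanningCoe
  have adj_L {a b : V} : L.Adj a b ↔ H.Adj x a ∧ H.Adj x b ∧ H.Adj a b := by
    simp [L, and_left_comm, and_assoc, and_comm]
  have support_L : L.support ⊆ H.neighborSet x := fun a ⟨b, hab⟩ => (adj_L.1 hab).1
  refine ⟨L, ⟨H, hH, fun a b hab => (adj_L.1 hab).2.2, support_L⟩, fun a ha => ?_, ?_⟩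
  · exact mem_filter.2 ⟨hsupp ⟨x, (support_L ha).symm⟩, support_L ha⟩
  · rw [card_interedges_eq_sum, mul_comm, ← smul_eq_mul]
    refine card_nsmul_le_sum _ _ _ fun a ha => ?_
    have hxa : H.Adj x a := (mem_filter.1 ha).2
    refine (hcommon x a hxa).trans (card_le_card fun b hb => ?_)
    simp only [mem_filter, adj_L] at hb ⊢
    exact ⟨⟨hb.1, hb.2.1⟩, hxa, hb.2⟩

-- Mader's argument: contract edges with few common neighbours for as long as there are any, then
-- pass to the link of a vertex and repeat.
open Classical in
theorem exists_not_cliqueFree (r : ℕ) (hQ : ∀ G x y, Q G → G.Adj x y → Q (contractInto G x y))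
    {W : Finset V} (hG : Q G) (hW : W.Nonempty) (hsupp : G.support ⊆ W)
    (hdense : 2 ^ r * #W ≤ #(G.interedges W W)) : ∃ H, Q H ∧ ¬ H.CliqueFree (r + 2) := by
  induction r generalizing Q G W with
  | zero =>
    have hpos : 0 < 2 ^ 0 * #W := by simpa using hW.card_pos
    exact ⟨G, hG, SimpleGraph.cliqueFree_two.not.2 <|
      ne_bot_of_card_interedges_pos (hpos.trans_le hdense)⟩
  | succ r ih =>
    rw [pow_succ'] at hdense
    obtain ⟨H, U, hH, hHU, hne, hcommon⟩ :=
      exists_forall_adj_le_card_common hQ (by positivity) hG hW hsupp hdense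
    obtain ⟨x, y, hxy⟩ := SimpleGraph.ne_bot_iff_exists_adj.1 hne
    obtain ⟨L, hL, hLU, hLdense⟩ := exists_isSublink_dense hH hHU hcommon x
    have hy : y ∈ ({b ∈ U | H.Adj x b} : Finset V) := mem_filter.2 ⟨hHU ⟨x, hxy.symm⟩, hxy⟩
    obtain ⟨K, hK, hcl⟩ := ih (fun _ _ _ h hab => h.contractInto hQ hab) hL ⟨y, hy⟩ hLU hLdense
    exact hK.exists_not_cliqueFree (by lia) hcl

end Contraction

open Classical in
theorem IsCrossingCochain.exists_contractInto {V : Type*} {κ : V → V → ℤ} {H : SimpleGraph V}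
    {τ : V → V → V → ℤ} (h : IsCrossingCochain κ H τ) {x y : V} (hxy : H.Adj x y) :
    ∃ τ', IsCrossingCochain κ (contractInto H x y) τ' := by
  have via {a b : V} (hab : (contractInto H x y).Adj a b) (hH : ¬ H.Adj a b) :
      H.Adj a y ∧ H.Adj y b ∧ (a = x ∨ b = x) := by
    obtain ⟨-, -, -, hab | ⟨rfl, hyb⟩ | ⟨rfl, hya⟩⟩ := (contractInto_adj hxy.ne).1 hab
    exacts [absurd hab hH, ⟨hxy, hyb, Or.inl rfl⟩, ⟨hya.symm, hxy.symm, Or.inr rfl⟩]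
  -- An edge of the contraction that is not an edge of `H` is drawn along a path through `y`.
  refine ⟨fun u a b => if H.Adj a b then τ u a b else τ u a y + τ u y b,
    fun u u' w w' hu hw h₁ h₂ h₃ h₄ => ?_⟩
  obtain ⟨-, huy, huy', -⟩ := (contractInto_adj hxy.ne).1 hu
  obtain ⟨-, hwy, hwy', -⟩ := (contractInto_adj hxy.ne).1 hw
  by_cases hu' : H.Adj u u' <;> by_cases hw' : H.Adj w w' <;>
    simp only [hu', hw', if_true, if_false]
  · exact h hu' hw' h₁ h₂ h₃ h₄
  · obtain ⟨hwy₁, hyw, -⟩ := via hw hw'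
    linear_combination h hu' hwy₁ h₁ huy h₃ huy' + h hu' hyw huy h₂ huy' h₄
  · obtain ⟨huy₁, hyu, -⟩ := via hu hu'
    linear_combination h huy₁ hw' h₁ h₂ hwy.symm hwy'.symm + h hyu hw' hwy.symm hwy'.symm h₃ h₄
  · obtain ⟨-, -, hxu⟩ := via hu hu'
    obtain ⟨-, -, hxw⟩ := via hw hw'
    grind

open Finset Classical in
theorem PlanarMap.card_interedges_le {V : Type*} (G : PlanarMap V) (W : Finset V) :
    #(G.graph.interedges W W) ≤ 8 * #W := by
  by_contra! hlt
  have hW : W.Nonempty := by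
    rw [nonempty_iff_ne_empty]
    rintro rfl
    simp at hlt
  obtain ⟨κ, τ, hτ, hκ⟩ := G.exists_isCrossingCochain
  obtain ⟨H, adj_H⟩ : ∃ H : SimpleGraph V, ∀ a b, H.Adj a b ↔ a ∈ W ∧ b ∈ W ∧ G.graph.Adj a b :=
    ⟨(G.graph.induce (W : Set V)).spanningCoe, by simp [and_left_comm, and_assoc, and_comm]⟩
  have card_H : #(H.interedges W W) = #(G.graph.interedges W W) := by
    congr 1
    ext ⟨a, b⟩
    simp only [SimpleGraph.mk_mem_interedges_iff, adj_H]
    tauto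
  obtain ⟨K, ⟨τ', hτ'⟩, hK⟩ := exists_not_cliqueFree 3 (Q := fun H => ∃ τ, IsCrossingCochain κ H τ)
    (fun _ _ _ ⟨_, h⟩ hxy => h.exists_contractInto hxy)
    ⟨τ, hτ.mono fun _ _ hab => ((adj_H _ _).1 hab).2.2⟩ hW (fun _ ⟨_, hab⟩ => ((adj_H _ _).1 hab).1)
    (by rw [card_H]; exact hlt.le)
  exact hK (hτ'.cliqueFree_five hκ)

/-! ### The roundabout graph -/

theorem apply_sInf_setOf_le_eq {α β : Type*} [ConditionallyCompleteLinearOrder α] [OrderBot α]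
    [TopologicalSpace α] [OrderTopology α] [DenselyOrdered α] [LinearOrder β] [TopologicalSpace β]
    [OrderClosedTopology β] {f : α → β} (hf : Continuous f) {r : β} (hbot : f ⊥ ≤ r) {t : α}
    (ht : r ≤ f t) : f (sInf {s | r ≤ f s}) = r := by
  have hmem : r ≤ f (sInf {s | r ≤ f s}) :=
    (isClosed_le continuous_const hf).csInf_mem ⟨t, ht⟩ (OrderBot.bddBelow _)
  obtain ⟨s, hs, hsr⟩ := intermediate_value_Icc bot_le hf.continuousOn ⟨hbot, hmem⟩
  have hle : sInf {s | r ≤ f s} ≤ s := csInf_le (OrderBot.bddBelow _) hsr.ge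
  rw [le_antisymm hle hs.2, hsr]

theorem exists_consecutive_mem_notMem {ι α : Type*} [CircularPreorder α] (f : ι → α) {F D : Set ι}
    (hF : F.Finite) (hD : (F ∩ D).Nonempty) (hD' : (F \ D).Nonempty) :
    ∃ e ∈ F ∩ D, ∃ e' ∈ F \ D, ∀ x ∈ F, ¬ sbtw (f e) (f x) (f e') := by
  let between (q : ι × ι) : Set ι := {x ∈ F | sbtw (f q.1) (f x) (f q.2)}
  have finite_between (q) : (between q).Finite := hF.subset (Set.sep_subset _ _)
  obtain ⟨⟨e, e'⟩, ⟨he, he'⟩, hmin⟩ := Set.exists_min_image ((F ∩ D) ×ˢ (F \ D))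
    (fun q => (between q).ncard) ((hF.inter_of_left D).prod (hF.sdiff)) (hD.prod hD')
  refine ⟨e, he, e', he', fun x hx hs => ?_⟩
  have hx' : x ∈ between (e, e') := ⟨hx, hs⟩
  by_cases hxD : x ∈ D
  · refine (hmin (x, e') ⟨⟨hx, hxD⟩, he'⟩).not_gt (Set.ncard_lt_ncard ?_ (finite_between _))
    exact ⟨fun y hy => ⟨hy.1, hs.trans_left hy.2⟩, fun hsub => sbtw_irrefl_left (hsub hx').2⟩
  · refine (hmin (e, x) ⟨he, hx, hxD⟩).not_gt (Set.ncard_lt_ncard ?_ (finite_between _))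
    exact ⟨fun y hy => ⟨hy.1, sbtw_trans_right hy.2 hs⟩,
      fun hsub => sbtw_irrefl_right (hsub hx').2⟩

namespace PlanarMap

variable {V : Type*} (G : PlanarMap V)

theorem eq_of_arc_eq_arc {u v v' : V} (h : G.graph.Adj u v) (h' : G.graph.Adj u v')
    {t t' : unitInterval} (heq : G.arc u v h t = G.arc u v' h' t')
    (hne : G.arc u v h t ≠ G.pt u) : v = v' := by
  by_contra hvv'
  obtain ⟨x, hx⟩ := G.arc_disjoint u v h u v' h' t t' (by simp [hvv', h'.ne]) heq
  have hxu : x ≠ u := fun hxu => hne (hxu ▸ hx)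
  have hxv : x = v := (G.arc_vertex u v h t x hx).resolve_left hxu
  have hxv' : x = v' := (G.arc_vertex u v' h' t' x (heq ▸ hx)).resolve_left hxu
  exact hvv' (hxv.symm.trans hxv')

theorem radius_le_dist {u v : V} (h : G.graph.Adj u v) :
    G.radius u ≤ dist (G.pt v) (G.pt u) := by
  have hle : Metric.infDist (G.pt u) (G.pt '' G.graph.neighborSet u) ≤ dist (G.pt u) (G.pt v) :=
    Metric.infDist_le_dist_of_mem ⟨v, h, rfl⟩
  rw [dist_comm, radius]
  linarith [dist_nonneg (x := G.pt u) (y := G.pt v)]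

variable {G}

theorem radius_pos {u v : V} (hfin : (G.graph.neighborSet u).Finite) (h : G.graph.Adj u v) :
    0 < G.radius u := by
  have hne : (G.pt '' G.graph.neighborSet u).Nonempty := ⟨_, v, h, rfl⟩
  refine half_pos (((hfin.image _).isClosed.notMem_iff_infDist_pos hne).1 ?_)
  rintro ⟨w, hw, hwu⟩
  exact hw.ne (G.pt_injective hwu).symm

theorem dist_arc_exitTime (d : G.graph.Dart) :
    dist (G.arc d.fst d.snd d.adj (G.exitTime d)) (G.pt d.fst) = G.radius d.fst := by
  have hnonneg : 0 ≤ G.radius d.fst := div_nonneg Metric.infDist_nonneg zero_le_two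
  refine apply_sInf_setOf_le_eq (f := fun t => dist (G.arc d.fst d.snd d.adj t) (G.pt d.fst))
    (by fun_prop) (t := 1) ?_ ?_
  · rw [show (⊥ : unitInterval) = 0 from rfl]
    simpa using hnonneg
  · simpa using G.radius_le_dist d.adj

theorem exitAngle_injOn {v : V} (hfin : (G.graph.neighborSet v).Finite) :
    Set.InjOn G.exitAngle {d | d.fst = v} := by
  rintro ⟨⟨_, w⟩, hw⟩ rfl ⟨⟨v, w'⟩, hw'⟩ (rfl : v = _) h
  have hd := dist_arc_exitTime ⟨(v, w), hw⟩
  have hd' := dist_arc_exitTime ⟨(v, w'), hw'⟩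
  have heq := sub_left_injective <| Complex.ext_norm_arg
    (by rw [← dist_eq_norm, ← dist_eq_norm, hd, hd']) (Complex.arg_coe_angle_eq_iff.1 h)
  have hne := dist_pos.1 (hd ▸ radius_pos hfin hw)
  cases G.eq_of_arc_eq_arc hw hw' heq hne
  rfl

theorem IsNextAt.right_unique {d d' d'' : G.graph.Dart}
    (hfin : (G.graph.neighborSet d.fst).Finite)
    (h : G.IsNextAt d d') (h' : G.IsNextAt d d'') : d' = d'' := by
  have h₁ := btw_iff_not_sbtw.2 (h.2.2 d'' h'.1.symm)
  have h₂ := btw_iff_not_sbtw.2 (h'.2.2 d' h.1.symm)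
  have inj := exitAngle_injOn hfin
  rcases h₁.antisymm h₂.cyclic_left.cyclic_left with heq | heq | heq
  · exact inj h.1.symm h'.1.symm heq
  · exact absurd (inj h'.1.symm rfl heq).symm h'.2.1
  · exact absurd (inj rfl h.1.symm heq) h.2.1

theorem IsNextAt.left_unique {d d' d'' : G.graph.Dart}
    (hfin : (G.graph.neighborSet d.fst).Finite)
    (h : G.IsNextAt d' d) (h' : G.IsNextAt d'' d) : d' = d'' := by
  have h₁ := btw_iff_not_sbtw.2 (h.2.2 d'' (h'.1.trans h.1.symm))
  have h₂ := btw_iff_not_sbtw.2 (h'.2.2 d' (h.1.trans h'.1.symm))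
  have inj := exitAngle_injOn hfin
  rcases h₁.antisymm h₂.cyclic_left with heq | heq | heq
  · exact absurd (inj h'.1 rfl heq.symm).symm h'.2.1.symm
  · exact (inj h'.1 h.1 heq).symm
  · exact absurd (inj h.1 rfl heq) h.2.1

end PlanarMap

open Classical in
/-- The inner vertex boundary of `D`: the vertices of `D` with a neighbour outside `D`. -/
def innerBoundary {X : Type*} (R : SimpleGraph X) (D : Finset X) : Finset X :=
  {x ∈ D | ∃ y ∉ D, R.Adj x y}

theorem mem_innerBoundary {X : Type*} {R : SimpleGraph X} {D : Finset X} {x : X} :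
    x ∈ innerBoundary R D ↔ x ∈ D ∧ ∃ y ∉ D, R.Adj x y := by
  simp [innerBoundary]

/-- The edge isoperimetric inequality with constant `K`: the degrees of the vertices in a finite
set add up to at most `K` times the number of edges that leave the set. -/
def IsEdgeIsoperimetric {X : Type*} [DecidableEq X] (R : SimpleGraph X) [R.LocallyFinite]
    (K : ℝ) : Prop :=
  ∀ D : Finset X, ∑ x ∈ D, (R.degree x : ℝ) ≤ K * ∑ x ∈ D, ((R.neighborFinset x \ D).card : ℝ)

open Finset in
theorem isEdgeIsoperimetric_of_degree_le {X : Type*} [DecidableEq X] {R : SimpleGraph X}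
    [R.LocallyFinite] {C : ℝ} (hC : 0 ≤ C) {Δ : ℕ} (hdeg : ∀ x, R.degree x ≤ Δ)
    (h : ∀ D : Finset X, (#D : ℝ) ≤ C * #(innerBoundary R D)) :
    IsEdgeIsoperimetric R (Δ * C) := by
  intro D
  have hI : #(innerBoundary R D) ≤ ∑ x ∈ D, #(R.neighborFinset x \ D) :=
    calc #(innerBoundary R D) = ∑ x ∈ innerBoundary R D, 1 := card_eq_sum_ones _
      _ ≤ ∑ x ∈ innerBoundary R D, #(R.neighborFinset x \ D) := by
        refine sum_le_sum fun x hx => card_pos.2 ?_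
        obtain ⟨-, y, hy, hxy⟩ := mem_innerBoundary.1 hx
        exact ⟨y, by simp [hxy, hy]⟩
      _ ≤ ∑ x ∈ D, #(R.neighborFinset x \ D) :=
        sum_le_sum_of_subset fun x hx => (mem_innerBoundary.1 hx).1
  calc ∑ x ∈ D, (R.degree x : ℝ) ≤ #D • (Δ : ℝ) :=
        sum_le_card_nsmul _ _ _ fun x _ => by exact_mod_cast hdeg x
    _ = Δ * #D := by rw [nsmul_eq_mul, mul_comm]
    _ ≤ Δ * (C * #(innerBoundary R D)) := by gcongr; exact h D
    _ ≤ Δ * (C * ∑ x ∈ D, (#(R.neighborFinset x \ D) : ℝ)) := by gcongr; exact_mod_cast hI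
    _ = Δ * C * ∑ x ∈ D, (#(R.neighborFinset x \ D) : ℝ) := by ring

namespace PlanarMap

variable {V : Type*} {G : PlanarMap V}

theorem neighborSet_roundabout (d : G.graph.Dart) :
    G.roundabout.neighborSet d = insert d.symm ({e | G.IsNextAt d e} ∪ {e | G.IsNextAt e d}) :=
  rfl

theorem encard_neighborSet_roundabout_le {d : G.graph.Dart}
    (hfin : (G.graph.neighborSet d.fst).Finite) : (G.roundabout.neighborSet d).encard ≤ 3 := by
  have next : {e | G.IsNextAt d e}.encard ≤ 1 :=
    Set.encard_le_one_iff.2 fun _ _ h h' => h.right_unique hfin h'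
  have previous : {e | G.IsNextAt e d}.encard ≤ 1 :=
    Set.encard_le_one_iff.2 fun _ _ h h' => h.left_unique hfin h'
  rw [neighborSet_roundabout]
  calc (insert d.symm ({e | G.IsNextAt d e} ∪ {e | G.IsNextAt e d})).encard
      ≤ ({e | G.IsNextAt d e} ∪ {e | G.IsNextAt e d}).encard + 1 := Set.encard_insert_le _ _
    _ ≤ 1 + 1 + 1 := by grw [Set.encard_union_le, next, previous]
    _ = 3 := by norm_num

theorem finite_setOf_fst_eq {v : V} (hfin : (G.graph.neighborSet v).Finite) :
    {d : G.graph.Dart | d.fst = v}.Finite := by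
  refine Set.Finite.of_finite_image (hfin.subset ?_) (f := fun d => d.snd) ?_
  · rintro _ ⟨d, rfl, rfl⟩
    exact d.adj
  · exact fun d hd d' hd' h => SimpleGraph.Dart.ext _ _ (Prod.ext (hd.trans hd'.symm) h)

theorem exists_isNextAt {d d' : G.graph.Dart} (hfin : (G.graph.neighborSet d.fst).Finite)
    {D : Set G.graph.Dart} (hd : d ∈ D) (hd' : d' ∉ D) (hfst : d'.fst = d.fst) :
    ∃ e ∈ D, ∃ e' ∉ D, e.fst = d.fst ∧ G.IsNextAt e e' := by
  obtain ⟨e, ⟨he, heD⟩, e', ⟨he', heD'⟩, hno⟩ := exists_consecutive_mem_notMem G.exitAngle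
    (finite_setOf_fst_eq hfin) (D := D) ⟨d, rfl, hd⟩ ⟨d', hfst, hd'⟩
  exact ⟨e, heD, e', heD', he, he.trans he'.symm, ne_of_mem_of_not_mem heD heD',
    fun x hx => hno x (hx.trans he)⟩

section Isoperimetry

open Finset

open Classical in
/-- The vertices all of whose darts, of which there is at least one, lie in `D`. -/
def fullVertices (D : Finset G.graph.Dart) : Finset V :=
  {v ∈ D.image (·.fst) | ∀ d : G.graph.Dart, d.fst = v → d ∈ D}

open Classical in
/-- The vertices with a dart in `D` and another one outside `D`. -/
def partialVertices (D : Finset G.graph.Dart) : Finset V :=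
  {v ∈ D.image (·.fst) | ¬ ∀ d : G.graph.Dart, d.fst = v → d ∈ D}

open Classical in
theorem card_partialVertices_le (hfin : ∀ v, (G.graph.neighborSet v).Finite)
    (D : Finset G.graph.Dart) : #(partialVertices D) ≤ #(innerBoundary G.roundabout D) := by
  suffices h : partialVertices D ⊆ (innerBoundary G.roundabout D).image (·.fst) from
    (card_le_card h).trans card_image_le
  intro v hv
  obtain ⟨hvD, hv⟩ := mem_filter.1 hv
  obtain ⟨d, hd, rfl⟩ := mem_image.1 hvD
  push Not at hv
  obtain ⟨d', hfst, hd'⟩ := hv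
  obtain ⟨e, he, e', he', hed, hnext⟩ := exists_isNextAt (hfin _) (D := D) hd hd' hfst
  exact mem_image.2 ⟨e, mem_innerBoundary.2 ⟨he, e', he', Or.inr (Or.inl hnext)⟩, hed⟩

open Classical in
theorem card_symm_mem_le (D : Finset G.graph.Dart) :
    #{d ∈ D | d.symm ∈ D} ≤ 8 * #(D.image (·.fst)) := by
  refine le_trans (card_le_card_of_injOn (·.toProd) (fun d hd => ?_)
    (SimpleGraph.Dart.toProd_injective.injOn)) (G.card_interedges_le _)
  obtain ⟨hd, hd'⟩ := mem_filter.1 hd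
  exact G.graph.mk_mem_interedges_iff.2
    ⟨mem_image_of_mem _ hd, mem_image.2 ⟨d.symm, hd', rfl⟩, d.adj⟩

open Classical in
theorem filter_symm_notMem_subset (D : Finset G.graph.Dart) :
    {d ∈ D | d.symm ∉ D} ⊆ innerBoundary G.roundabout D := fun d hd =>
  mem_innerBoundary.2 ⟨(mem_filter.1 hd).1, d.symm, (mem_filter.1 hd).2, Or.inl rfl⟩

open Classical in
theorem card_le_card_fullVertices_add (hfin : ∀ v, (G.graph.neighborSet v).Finite)
    (D : Finset G.graph.Dart) :
    #D ≤ 8 * #(fullVertices D) + 9 * #(innerBoundary G.roundabout D) := by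
  have darts : #{d ∈ D | d.symm ∈ D} + #{d ∈ D | d.symm ∉ D} = #D :=
    card_filter_add_card_filter_not _
  have vertices : #(fullVertices D) + #(partialVertices D) = #(D.image (·.fst)) :=
    card_filter_add_card_filter_not _
  have inside := card_symm_mem_le D
  have outside := card_le_card (filter_symm_notMem_subset D)
  have boundary := card_partialVertices_le hfin D
  lia

open Classical in
theorem ncard_vertexBoundary_fullVertices_le (hfin : ∀ v, (G.graph.neighborSet v).Finite)
    (D : Finset G.graph.Dart) :
    (G.graph.vertexBoundary (fullVertices D)).ncard ≤ 2 * #(innerBoundary G.roundabout D) := by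
  have hsub : G.graph.vertexBoundary (fullVertices D) ⊆
      ({d ∈ D | d.symm ∉ D}.image (·.snd) ∪ partialVertices D : Finset V) := by
    rintro w ⟨hw, v, hv, hvw⟩
    let d : G.graph.Dart := ⟨(v, w), hvw⟩
    have hd : d ∈ D := (mem_filter.1 hv).2 d rfl
    by_cases hd' : d.symm ∈ D
    · have hwD : w ∈ D.image (·.fst) := mem_image.2 ⟨d.symm, hd', rfl⟩
      exact mem_union_right _ (mem_filter.2 ⟨hwD, fun h => hw (mem_filter.2 ⟨hwD, h⟩)⟩)
    · exact mem_union_left _ (mem_image.2 ⟨d, mem_filter.2 ⟨hd, hd'⟩, rfl⟩)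
  calc (G.graph.vertexBoundary (fullVertices D)).ncard
      ≤ #({d ∈ D | d.symm ∉ D}.image (·.snd) ∪ partialVertices D) := by
        rw [← Set.ncard_coe_finset]
        exact Set.ncard_le_ncard hsub (finite_toSet _)
    _ ≤ #{d ∈ D | d.symm ∉ D} + #(partialVertices D) :=
        (card_union_le _ _).trans (add_le_add_left card_image_le _)
    _ ≤ 2 * #(innerBoundary G.roundabout D) := by
        rw [two_mul]
        exact add_le_add (card_le_card (filter_symm_notMem_subset D))
          (card_partialVertices_le hfin D)

theorem card_le_mul_card_innerBoundary (hfin : ∀ v, (G.graph.neighborSet v).Finite) {γ : ℝ}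
    (hγ : 0 < γ) (hiso : ∀ S : Finset V, γ * #S ≤ (G.graph.vertexBoundary S).ncard)
    (D : Finset G.graph.Dart) : (#D : ℝ) ≤ (16 / γ + 9) * #(innerBoundary G.roundabout D) := by
  have hfull : (#(fullVertices D) : ℝ) ≤ 2 * #(innerBoundary G.roundabout D) / γ := by
    rw [le_div_iff₀' hγ]
    exact (hiso _).trans (by exact_mod_cast ncard_vertexBoundary_fullVertices_le hfin D)
  calc (#D : ℝ) ≤ 8 * #(fullVertices D) + 9 * #(innerBoundary G.roundabout D) := by
        exact_mod_cast card_le_card_fullVertices_add hfin D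
    _ ≤ 8 * (2 * #(innerBoundary G.roundabout D) / γ) + 9 * #(innerBoundary G.roundabout D) := by
        gcongr
    _ = (16 / γ + 9) * #(innerBoundary G.roundabout D) := by ring

open Classical in
theorem exists_isEdgeIsoperimetric_roundabout [G.roundabout.LocallyFinite]
    (hfin : ∀ v, (G.graph.neighborSet v).Finite) (hna : G.graph.IsNonamenable) :
    ∃ K, 0 < K ∧ IsEdgeIsoperimetric G.roundabout K := by
  obtain ⟨-, γ, hγ, hiso⟩ := hna
  refine ⟨(3 : ℕ) * (16 / γ + 9), by positivity, isEdgeIsoperimetric_of_degree_le (by positivity)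
    (fun d => ?_) (card_le_mul_card_innerBoundary hfin hγ hiso)⟩
  have h := encard_neighborSet_roundabout_le (hfin d.fst)
  rw [← SimpleGraph.coe_neighborFinset, Set.encard_coe_eq_coe_finsetCard] at h
  exact_mod_cast h

end Isoperimetry

end PlanarMap

/-! ### From the isoperimetric inequality to a Poincaré inequality -/

section Poincare

open Finset

variable {X : Type*} {R : SimpleGraph X} [R.LocallyFinite] {S : Finset X} {K : ℝ}

theorem sum_sum_neighborFinset_le {g : X → ℝ} (hg : ∀ x, 0 ≤ g x) (hgS : ∀ x ∉ S, g x = 0) :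
    ∑ x ∈ S, ∑ y ∈ R.neighborFinset x, g y ≤ ∑ x ∈ S, R.degree x * g x := by
  classical
  calc ∑ x ∈ S, ∑ y ∈ R.neighborFinset x, g y
      = ∑ x ∈ S, ∑ y ∈ R.neighborFinset x ∩ S, g y :=
        sum_congr rfl fun x _ => (sum_subset inter_subset_left fun y hy hyS =>
          hgS y fun h => hyS (mem_inter.2 ⟨hy, h⟩)).symm
    _ = ∑ y ∈ S, ∑ _x ∈ R.neighborFinset y ∩ S, g y :=
        sum_comm' fun x y => by simp [R.adj_comm x y]; tauto
    _ = ∑ y ∈ S, #(R.neighborFinset y ∩ S) * g y := by simp only [sum_const, nsmul_eq_mul]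
    _ ≤ ∑ y ∈ S, R.degree y * g y := by
        gcongr with y
        · exact hg y
        · exact card_le_card inter_subset_left

theorem sum_sum_sq_sub_le {u : X → ℝ} (hu : ∀ x ∉ S, u x = 0) :
    ∑ x ∈ S, ∑ y ∈ R.neighborFinset x, (u x - u y) ^ 2 ≤
      2 * ∑ x ∈ S, u x * (R.degree x * u x - ∑ y ∈ R.neighborFinset x, u y) := by
  have swap := sum_sum_neighborFinset_le (R := R) (fun x => sq_nonneg (u x))
    (fun x hx => by simp [hu x hx] : ∀ x ∉ S, u x ^ 2 = 0)
  have expand (x : X) : ∑ y ∈ R.neighborFinset x, (u x - u y) ^ 2 =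
      2 * (u x * (R.degree x * u x - ∑ y ∈ R.neighborFinset x, u y)) - R.degree x * u x ^ 2 +
        ∑ y ∈ R.neighborFinset x, u y ^ 2 := by
    simp only [sub_sq, sum_add_distrib, sum_sub_distrib, ← mul_sum, sum_const, nsmul_eq_mul,
      SimpleGraph.card_neighborFinset_eq_degree]
    ring
  simp only [expand, sum_add_distrib, sum_sub_distrib, ← mul_sum]
  linarith

variable [DecidableEq X]

theorem IsEdgeIsoperimetric.sum_degree_mul_indicator_le (h : IsEdgeIsoperimetric R K) {f : X → ℝ}
    (hfS : ∀ x ∉ S, f x = 0) (t : ℝ) :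
    ∑ x ∈ S, (R.degree x : ENNReal) * (Set.Ico 0 (f x)).indicator 1 t ≤
      ENNReal.ofReal K *
        ∑ x ∈ S, ∑ y ∈ R.neighborFinset x, (Set.Ico (f y) (f x)).indicator 1 t := by
  rcases lt_or_ge t 0 with ht | ht
  · simp [ht.not_ge]
  set D := {x ∈ S | t < f x}
  have notMem_D (y : X) : y ∉ D ↔ f y ≤ t := by
    by_cases hy : y ∈ S
    · simp [D, hy]
    · simp [D, hy, hfS y hy, ht]
  have left : ∑ x ∈ S, (R.degree x : ENNReal) * (Set.Ico 0 (f x)).indicator 1 t =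
      ENNReal.ofReal (∑ x ∈ D, (R.degree x : ℝ)) := by
    rw [← Nat.cast_sum, ENNReal.ofReal_natCast]
    simp [D, sum_filter, Set.indicator_apply, ht]
  have right : ∑ x ∈ S, ∑ y ∈ R.neighborFinset x, (Set.Ico (f y) (f x)).indicator 1 t =
      ENNReal.ofReal (∑ x ∈ D, (#(R.neighborFinset x \ D) : ℝ)) := by
    rw [← Nat.cast_sum, ENNReal.ofReal_natCast, sum_filter, Nat.cast_sum]
    refine sum_congr rfl fun x _ => ?_
    split_ifs with hx
    · simp [Set.indicator_apply, hx, sdiff_eq_filter, notMem_D]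
    · simp [hx]
  rw [left, right, ← ENNReal.ofReal_mul' (sum_nonneg fun _ _ => Nat.cast_nonneg _)]
  exact ENNReal.ofReal_le_ofReal (h D)

theorem IsEdgeIsoperimetric.sum_degree_mul_le (h : IsEdgeIsoperimetric R K) (hK : 0 ≤ K)
    {f : X → ℝ} (hf : ∀ x, 0 ≤ f x) (hfS : ∀ x ∉ S, f x = 0) :
    ∑ x ∈ S, R.degree x * f x ≤ K * ∑ x ∈ S, ∑ y ∈ R.neighborFinset x, |f x - f y| := by
  have layer (a b : ℝ) : ENNReal.ofReal (b - a) = ∫⁻ t, (Set.Ico a b).indicator 1 t := by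
    rw [lintegral_indicator_one measurableSet_Ico, Real.volume_Ico]
  have meas (a b : ℝ) : Measurable ((Set.Ico a b).indicator (1 : ℝ → ENNReal)) :=
    measurable_one.indicator measurableSet_Ico
  have key : ENNReal.ofReal (∑ x ∈ S, R.degree x * f x) ≤
      ENNReal.ofReal (K * ∑ x ∈ S, ∑ y ∈ R.neighborFinset x, |f x - f y|) :=
    calc ENNReal.ofReal (∑ x ∈ S, R.degree x * f x)
        = ∑ x ∈ S, R.degree x * ∫⁻ t, (Set.Ico 0 (f x)).indicator 1 t := by
          rw [ENNReal.ofReal_sum_of_nonneg fun x _ => mul_nonneg (Nat.cast_nonneg _) (hf x)]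
          simp [← layer, ENNReal.ofReal_mul]
      _ = ∫⁻ t, ∑ x ∈ S, (R.degree x : ENNReal) * (Set.Ico 0 (f x)).indicator 1 t := by
          rw [lintegral_finsetSum _ fun x _ => (meas _ _).const_mul _]
          exact sum_congr rfl fun x _ => (lintegral_const_mul _ (meas _ _)).symm
      _ ≤ ∫⁻ t, ENNReal.ofReal K *
            ∑ x ∈ S, ∑ y ∈ R.neighborFinset x, (Set.Ico (f y) (f x)).indicator 1 t :=
          lintegral_mono (h.sum_degree_mul_indicator_le hfS)
      _ = ENNReal.ofReal K * ∑ x ∈ S, ∑ y ∈ R.neighborFinset x, ENNReal.ofReal (f x - f y) := by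
          rw [lintegral_const_mul _ (by fun_prop), lintegral_finsetSum _ (by fun_prop)]
          simp only [lintegral_finsetSum _ fun y _ => meas (f y) _, layer]
      _ ≤ ENNReal.ofReal K * ∑ x ∈ S, ∑ y ∈ R.neighborFinset x, ENNReal.ofReal |f x - f y| := by
          gcongr
          exact le_abs_self _
      _ = ENNReal.ofReal (K * ∑ x ∈ S, ∑ y ∈ R.neighborFinset x, |f x - f y|) := by
          rw [ENNReal.ofReal_mul hK, ENNReal.ofReal_sum_of_nonneg fun x _ => by positivity]
          simp only [ENNReal.ofReal_sum_of_nonneg fun _ _ => abs_nonneg _]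
  exact (ENNReal.ofReal_le_ofReal_iff (by positivity)).1 key

theorem abs_sq_sub_sq_le (hK : 0 < K) (a b : ℝ) :
    |a ^ 2 - b ^ 2| ≤ 2 * K * (a - b) ^ 2 + (a ^ 2 + b ^ 2) / (4 * K) :=
  calc |a ^ 2 - b ^ 2| = |a - b| * |a + b| := by rw [sq_sub_sq, abs_mul, mul_comm]
    _ ≤ 2 * K * |a - b| ^ 2 + |a + b| ^ 2 / (8 * K) := by
        rw [← sub_nonneg]
        convert (by positivity : 0 ≤ (4 * K * |a - b| - |a + b|) ^ 2 / (8 * K)) using 1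
        field_simp
        ring
    _ ≤ 2 * K * (a - b) ^ 2 + (a ^ 2 + b ^ 2) / (4 * K) := by
        rw [sq_abs, sq_abs, show 8 * K = 2 * (4 * K) by ring, ← div_div]
        gcongr
        linarith [sq_nonneg (a - b)]

theorem IsEdgeIsoperimetric.sum_degree_mul_sq_le_energy (h : IsEdgeIsoperimetric R K) (hK : 0 < K)
    {u : X → ℝ} (hu : ∀ x ∉ S, u x = 0) :
    ∑ x ∈ S, R.degree x * u x ^ 2 ≤
      4 * K ^ 2 * ∑ x ∈ S, ∑ y ∈ R.neighborFinset x, (u x - u y) ^ 2 := by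
  have husq : ∀ x ∉ S, u x ^ 2 = 0 := fun x hx => by simp [hu x hx]
  have swap := sum_sum_neighborFinset_le (R := R) (fun x => sq_nonneg (u x)) husq
  have main : ∑ x ∈ S, R.degree x * u x ^ 2 ≤
      2 * K ^ 2 * ∑ x ∈ S, ∑ y ∈ R.neighborFinset x, (u x - u y) ^ 2 +
        (∑ x ∈ S, R.degree x * u x ^ 2 +
          ∑ x ∈ S, ∑ y ∈ R.neighborFinset x, u y ^ 2) / 4 :=
    calc ∑ x ∈ S, R.degree x * u x ^ 2
        ≤ K * ∑ x ∈ S, ∑ y ∈ R.neighborFinset x, |u x ^ 2 - u y ^ 2| :=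
          h.sum_degree_mul_le hK.le (fun x => sq_nonneg (u x)) husq
      _ ≤ K * ∑ x ∈ S, ∑ y ∈ R.neighborFinset x,
            (2 * K * (u x - u y) ^ 2 + (u x ^ 2 + u y ^ 2) / (4 * K)) := by
          gcongr
          exact abs_sq_sub_sq_le hK _ _
      _ = _ := by
          simp only [sum_add_distrib, ← mul_sum, ← sum_div, sum_const, nsmul_eq_mul,
            SimpleGraph.card_neighborFinset_eq_degree]
          field_simp
  linarith

theorem IsEdgeIsoperimetric.sum_degree_mul_sq_le (h : IsEdgeIsoperimetric R K) (hK : 0 < K)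
    {u : X → ℝ} (hu : ∀ x ∉ S, u x = 0) :
    ∑ x ∈ S, R.degree x * u x ^ 2 ≤
      8 * K ^ 2 * ∑ x ∈ S, u x * (R.degree x * u x - ∑ y ∈ R.neighborFinset x, u y) := by
  refine (h.sum_degree_mul_sq_le_energy hK hu).trans ?_
  rw [show 8 * K ^ 2 = 4 * K ^ 2 * 2 by ring, mul_assoc _ (2 : ℝ)]
  gcongr
  exact sum_sum_sq_sub_le hu

end Poincare

/-! ### The walk killed on its return -/

section Walk

open Finset Preorder

variable {X : Type*}

/-- The event that a trajectory does not visit `o` at the times `1, …, n`. -/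
def avoids (o : X) (n : ℕ) : Set (ℕ → X) := {ω | ∀ k ∈ Set.Icc 1 n, ω k ≠ o}

theorem avoids_zero (o : X) : avoids o 0 = Set.univ := by
  simp [avoids]

theorem avoids_succ (o : X) (n : ℕ) :
    avoids o (n + 1) = avoids o n ∩ {ω | ω (n + 1) ≠ o} := by
  ext ω
  simp only [avoids, ← Set.insert_Icc_right_eq_Icc_add_one (Nat.le_add_left 1 n)]
  simp [and_comm]

theorem setOf_exists_return_subset (o : X) :
    {ω : ℕ → X | ∃ n, 1 ≤ n ∧ ω n = o} ⊆ ⋃ n, avoids o n ∩ {ω | ω (n + 1) = o} := by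
  classical
  intro ω hω
  obtain ⟨hpos, hret⟩ := Nat.find_spec hω
  refine Set.mem_iUnion.2 ⟨Nat.find hω - 1, fun k hk hko => ?_, ?_⟩
  · exact Nat.find_min hω (by have := hk.2; omega) ⟨hk.1, hko⟩
  · rwa [Set.mem_ofPred_eq, Nat.sub_add_cancel hpos]

variable [MeasurableSpace X] [DiscreteMeasurableSpace X]

theorem measurableSet_eval_eq {ι : Type*} (i : ι) (x : X) :
    MeasurableSet {ω : ι → X | ω i = x} :=
  (MeasurableSet.singleton x).preimage (measurable_pi_apply i)

theorem measurableSet_avoids (o : X) (n : ℕ) :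
    MeasurableSet[Filtration.piLE (X := fun _ => X) n] (avoids o n) := by
  have eval (k : ℕ) (hk : k ≤ n) : MeasurableSet[Filtration.piLE (X := fun _ => X) n]
      {ω : ℕ → X | ω k ≠ o} :=
    ⟨{z | z ⟨k, Set.mem_Iic.2 hk⟩ = o}ᶜ, (measurableSet_eval_eq _ o).compl, rfl⟩
  simp only [avoids, Set.ofPred_forall]
  exact .iInter fun k => .iInter fun hk => eval k hk.2

variable (R : SimpleGraph X) (o : X)

instance isProbabilityMeasure_walkLaw : IsProbabilityMeasure (R.walkLaw o) := by
  unfold SimpleGraph.walkLaw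
  infer_instance

theorem walkLaw_eq_traj :
    R.walkLaw o = Kernel.traj (X := fun _ => X) R.stepKernel 0 fun _ => o := by
  have hstart : (Measure.dirac o).map (MeasurableEquiv.piUnique fun _ : Iic 0 => X).symm =
      Measure.dirac fun _ => o := Measure.map_dirac o
  exact (congrArg (fun ν => ν.bind (Kernel.traj (X := fun _ => X) R.stepKernel 0)) hstart).trans
    (Measure.dirac_bind (Kernel.measurable _) _)

theorem walkLaw_eval_zero : (R.walkLaw o).map (· 0) = Measure.dirac o := by
  have h : (fun ω : ℕ → X => ω 0) =
      (fun z : Iic 0 → X => z ⟨0, mem_Iic.2 le_rfl⟩) ∘ frestrictLe (π := fun _ => X) 0 := rfl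
  rw [h, ← Measure.map_map (by fun_prop) (by fun_prop), walkLaw_eq_traj,
    ← Kernel.map_apply _ (by fun_prop), Kernel.traj_map_frestrictLe_of_le le_rfl,
    Kernel.deterministic_apply, Measure.map_dirac' (by fun_prop)]
  rfl

/-- The probability that simple random walk on `R` from `o` is at `x` at time `n` and has not
returned to `o` by then. -/
def killedMass (n : ℕ) (x : X) : ℝ := (R.walkLaw o).real (avoids o n ∩ {ω | ω n = x})

/-- The probability that simple random walk on `R` from `o` returns to `o` for the first time at
time `n + 1`. -/
def firstReturn (n : ℕ) : ℝ := (R.walkLaw o).real (avoids o n ∩ {ω | ω (n + 1) = o})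

theorem killedMass_zero (x : X) : killedMass R o 0 x = ({o} : Set X).indicator 1 x := by
  classical
  have h : killedMass R o 0 x = (Measure.dirac o).real {x} := by
    rw [killedMass, avoids_zero, Set.univ_inter, ← walkLaw_eval_zero R o,
      map_measureReal_apply (by fun_prop) (.singleton x)]
    rfl
  simp [h, measureReal_def, Set.indicator_apply, apply_ite ENNReal.toReal, eq_comm]

variable {R}

theorem killedMass_succ_self (n : ℕ) : killedMass R o (n + 1) o = 0 := by
  have h : avoids o (n + 1) ∩ {ω | ω (n + 1) = o} = ∅ := by
    ext ω
    simp [avoids_succ]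
  rw [killedMass, h, measureReal_empty]

variable [R.LocallyFinite]

theorem stepMeasure_singleton {x : X} (hx : 0 < R.degree x) (y : X) :
    R.stepMeasure x {y} =
      (R.neighborSet x).indicator (fun _ => (R.degree x : ENNReal)⁻¹) y := by
  classical
  have hne : (R.neighborSet x).Nonempty := (R.degree_pos_iff_exists_adj x).1 hx
  rw [SimpleGraph.stepMeasure, if_pos ⟨Set.toFinite _, hne⟩, ← SimpleGraph.coe_neighborFinset,
    ← coe_singleton, uniformOn_apply_finset]
  by_cases h : R.Adj x y <;> simp [h]

theorem walkLaw_step (hdeg : ∀ x, 0 < R.degree x) {n : ℕ} {E : Set (ℕ → X)}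
    (hE : MeasurableSet[Filtration.piLE (X := fun _ => X) n] E) (y : X) :
    R.walkLaw o (E ∩ {ω | ω (n + 1) = y}) =
      ∑ x ∈ R.neighborFinset y, (R.degree x : ENNReal)⁻¹ * R.walkLaw o (E ∩ {ω | ω n = x}) := by
  classical
  rw [Filtration.piLE_eq_comap_frestrictLe] at hE
  obtain ⟨A, hA, rfl⟩ := hE
  let past : (ℕ → X) → Iic n → X := frestrictLe n
  have meas_past : Measurable past := measurable_frestrictLe n
  let last (z : Iic n → X) : X := z ⟨n, mem_Iic.2 le_rfl⟩
  have meas_last (x : X) : MeasurableSet {z | last z = x} := measurableSet_eval_eq _ x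
  have transition (z : Iic n → X) : R.stepKernel n z {y} = ∑ x ∈ R.neighborFinset y,
      {z | last z = x}.indicator (fun _ => (R.degree x : ENNReal)⁻¹) z := by
    refine (stepMeasure_singleton (hdeg _) y).trans ?_
    simp [Set.indicator_apply, R.adj_comm y, last]
  have markov : (R.walkLaw o).map past ⊗ₘ R.stepKernel n =
      (R.walkLaw o).map fun ω => (past ω, ω (n + 1)) :=
    Kernel.map_frestrictLe_trajMeasure_compProd_eq_map_trajMeasure
  have : IsProbabilityMeasure ((R.walkLaw o).map past) :=
    Measure.isProbabilityMeasure_map meas_past.aemeasurable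
  calc R.walkLaw o (past ⁻¹' A ∩ {ω | ω (n + 1) = y})
      = (R.walkLaw o).map (fun ω => (past ω, ω (n + 1))) (A ×ˢ {y}) :=
        (Measure.map_apply (meas_past.prodMk (measurable_pi_apply _)) (hA.prod (.singleton y))).symm
    _ = ∫⁻ z in A, R.stepKernel n z {y} ∂(R.walkLaw o).map past := by
        rw [← markov, Measure.compProd_apply_prod hA (.singleton y)]
    _ = ∑ x ∈ R.neighborFinset y, (R.degree x : ENNReal)⁻¹ *
          (R.walkLaw o).map past ({z | last z = x} ∩ A) := by
        simp only [transition]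
        rw [lintegral_finsetSum _ fun x _ => measurable_const.indicator (meas_last x)]
        simp only [lintegral_indicator_const (meas_last _), Measure.restrict_apply (meas_last _)]
    _ = _ := by
        refine sum_congr rfl fun x _ => ?_
        rw [Measure.map_apply meas_past ((meas_last x).inter hA), Set.inter_comm]
        rfl

theorem walkLaw_real_avoids_step (hdeg : ∀ x, 0 < R.degree x) (n : ℕ) (y : X) :
    (R.walkLaw o).real (avoids o n ∩ {ω | ω (n + 1) = y}) =
      ∑ x ∈ R.neighborFinset y, killedMass R o n x / R.degree x := by
  rw [measureReal_def, walkLaw_step o hdeg (measurableSet_avoids o n), ENNReal.toReal_sum]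
  · simp only [ENNReal.toReal_mul, ENNReal.toReal_inv, ENNReal.toReal_natCast, killedMass,
      measureReal_def, div_eq_inv_mul]
  · exact fun x _ => ENNReal.mul_ne_top (by simpa using (hdeg x).ne') (measure_ne_top _ _)

theorem firstReturn_eq_sum (hdeg : ∀ x, 0 < R.degree x) (n : ℕ) :
    firstReturn R o n = ∑ x ∈ R.neighborFinset o, killedMass R o n x / R.degree x :=
  walkLaw_real_avoids_step o hdeg n o

theorem killedMass_succ_of_ne (hdeg : ∀ x, 0 < R.degree x) (n : ℕ) {y : X} (hy : y ≠ o) :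
    killedMass R o (n + 1) y = ∑ x ∈ R.neighborFinset y, killedMass R o n x / R.degree x := by
  have h : avoids o (n + 1) ∩ {ω | ω (n + 1) = y} = avoids o n ∩ {ω | ω (n + 1) = y} := by
    ext ω
    simp only [avoids_succ, Set.mem_inter_iff, Set.mem_ofPred_eq]
    exact ⟨fun h => ⟨h.1.1, h.2⟩, fun h => ⟨⟨h.1, h.2.trans_ne hy⟩, h.2⟩⟩
  rw [killedMass, h, walkLaw_real_avoids_step o hdeg]

theorem finite_support_killedMass (hdeg : ∀ x, 0 < R.degree x) (n : ℕ) :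
    (Function.support (killedMass R o n)).Finite := by
  induction n with
  | zero =>
    refine (Set.finite_singleton o).subset fun x hx => by_contra fun h => hx ?_
    rw [killedMass_zero, Set.indicator_of_notMem h]
  | succ n ih =>
    refine (ih.biUnion fun x _ => (R.neighborFinset x).finite_toSet).subset fun y hy => ?_
    have hyo : y ≠ o := by
      rintro rfl
      exact hy (killedMass_succ_self y n)
    rw [Function.mem_support, killedMass_succ_of_ne o hdeg n hyo] at hy
    obtain ⟨x, hx, hne⟩ := exists_ne_zero_of_sum_ne_zero hy
    refine Set.mem_biUnion (x := x) (left_ne_zero_of_mul hne) ?_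
    simpa [R.adj_comm] using hx

variable (R) in
/-- The Green function of the walk from `o` killed on its return to `o`, truncated at time `n`, as a
density with respect to the degree measure. -/
def killedGreen (n : ℕ) (x : X) : ℝ := ∑ k ∈ range (n + 1), killedMass R o k x / R.degree x

theorem killedGreen_nonneg (n : ℕ) (x : X) : 0 ≤ killedGreen R o n x :=
  sum_nonneg fun _ _ => div_nonneg measureReal_nonneg (Nat.cast_nonneg _)

theorem killedGreen_le_succ (n : ℕ) (x : X) : killedGreen R o n x ≤ killedGreen R o (n + 1) x :=
  sum_le_sum_of_subset_of_nonneg (range_mono (Nat.le_succ _))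
    fun _ _ _ => div_nonneg measureReal_nonneg (Nat.cast_nonneg _)

theorem killedGreen_self (n : ℕ) : killedGreen R o n o = (R.degree o : ℝ)⁻¹ := by
  rw [killedGreen, sum_range_succ', sum_eq_zero fun k _ => by rw [killedMass_succ_self, zero_div],
    killedMass_zero, Set.indicator_of_mem (Set.mem_singleton o), Pi.one_apply, zero_add, one_div]

theorem exists_support_killedGreen_subset (hdeg : ∀ x, 0 < R.degree x) (n : ℕ) :
    ∃ S : Finset X, ∀ x ∉ S, killedGreen R o n x = 0 := by
  have hfin : (⋃ k ∈ range (n + 1), Function.support (killedMass R o k)).Finite :=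
    (finite_toSet _).biUnion fun k _ => finite_support_killedMass o hdeg k
  refine ⟨hfin.toFinset, fun x hx => sum_eq_zero fun k hk => ?_⟩
  simp only [Set.Finite.mem_toFinset, Set.mem_iUnion, Function.mem_support, not_exists,
    not_not] at hx
  rw [hx k hk, zero_div]

theorem sum_killedGreen_neighborFinset_self (hdeg : ∀ x, 0 < R.degree x) (n : ℕ) :
    ∑ x ∈ R.neighborFinset o, killedGreen R o n x = ∑ k ∈ range (n + 1), firstReturn R o k := by
  simp only [firstReturn_eq_sum o hdeg, killedGreen]
  exact sum_comm

theorem sum_killedGreen_neighborFinset_of_ne (hdeg : ∀ x, 0 < R.degree x) (n : ℕ) {x : X}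
    (hx : x ≠ o) :
    ∑ y ∈ R.neighborFinset x, killedGreen R o n y = R.degree x * killedGreen R o (n + 1) x := by
  have hd : (R.degree x : ℝ) ≠ 0 := by exact_mod_cast (hdeg x).ne'
  have h0 : killedMass R o 0 x = 0 := by
    rw [killedMass_zero, Set.indicator_of_notMem (Set.notMem_singleton_iff.2 hx)]
  rw [killedGreen, ← sum_div, mul_div_cancel₀ _ hd, sum_range_succ', h0, add_zero]
  simp only [killedMass_succ_of_ne o hdeg _ hx, killedGreen]
  exact sum_comm

theorem sum_killedGreen_mul_laplacian_le (hdeg : ∀ x, 0 < R.degree x) (n : ℕ) {S : Finset X}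
    (ho : o ∈ S) :
    ∑ x ∈ S, killedGreen R o n x *
        (R.degree x * killedGreen R o n x - ∑ y ∈ R.neighborFinset x, killedGreen R o n y) ≤
      (R.degree o : ℝ)⁻¹ * (1 - ∑ k ∈ range (n + 1), firstReturn R o k) := by
  classical
  have hd : (R.degree o : ℝ) ≠ 0 := by exact_mod_cast (hdeg o).ne'
  rw [← add_sum_erase _ _ ho, killedGreen_self, mul_inv_cancel₀ hd,
    sum_killedGreen_neighborFinset_self o hdeg]
  refine add_le_of_nonpos_right (sum_nonpos fun x hx => ?_)
  rw [sum_killedGreen_neighborFinset_of_ne o hdeg n (mem_erase.1 hx).1, ← mul_sub]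
  exact mul_nonpos_of_nonneg_of_nonpos (killedGreen_nonneg o n x)
    (mul_nonpos_of_nonneg_of_nonpos (Nat.cast_nonneg _)
      (sub_nonpos.2 (killedGreen_le_succ o n x)))

theorem IsEdgeIsoperimetric.sum_firstReturn_le [DecidableEq X] {K : ℝ}
    (h : IsEdgeIsoperimetric R K) (hK : 0 < K) (hdeg : ∀ x, 0 < R.degree x) (n : ℕ) :
    ∑ k ∈ range (n + 1), firstReturn R o k ≤ 1 - 1 / (8 * K ^ 2) := by
  obtain ⟨S, hS⟩ := exists_support_killedGreen_subset o hdeg n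
  have hd : (0 : ℝ) < R.degree o := by exact_mod_cast hdeg o
  have ho : o ∈ S := by
    by_contra ho
    exact (inv_pos.2 hd).ne' ((killedGreen_self o n).symm.trans (hS o ho))
  have hu : (R.degree o : ℝ)⁻¹ * 1 ≤
      (R.degree o : ℝ)⁻¹ * (8 * K ^ 2 * (1 - ∑ k ∈ range (n + 1), firstReturn R o k)) :=
    calc (R.degree o : ℝ)⁻¹ * 1 = R.degree o * killedGreen R o n o ^ 2 := by
          rw [killedGreen_self]
          field_simp
      _ ≤ ∑ x ∈ S, R.degree x * killedGreen R o n x ^ 2 :=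
        single_le_sum (f := fun x => R.degree x * killedGreen R o n x ^ 2)
          (fun x _ => by positivity) ho
      _ ≤ 8 * K ^ 2 * ∑ x ∈ S, killedGreen R o n x * (R.degree x * killedGreen R o n x -
            ∑ y ∈ R.neighborFinset x, killedGreen R o n y) :=
        h.sum_degree_mul_sq_le hK hS
      _ ≤ 8 * K ^ 2 * ((R.degree o : ℝ)⁻¹ * (1 - ∑ k ∈ range (n + 1), firstReturn R o k)) := by
        gcongr
        exact sum_killedGreen_mul_laplacian_le o hdeg n ho
      _ = _ := by ring
  have := le_of_mul_le_mul_left hu (inv_pos.2 hd)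
  rw [le_sub_comm, div_le_iff₀ (by positivity)]
  linarith

end Walk

theorem IsEdgeIsoperimetric.isTransient {X : Type*} [DecidableEq X] {R : SimpleGraph X}
    [R.LocallyFinite] {K : ℝ} (h : IsEdgeIsoperimetric R K) (hK : 0 < K)
    (hdeg : ∀ x, 0 < R.degree x) : R.IsTransient := by
  intro o
  let : MeasurableSpace X := ⊤
  have : DiscreteMeasurableSpace X := ⟨fun _ => trivial⟩
  have hpartial (n : ℕ) : ∑ k ∈ Finset.range n,
      R.walkLaw o (avoids o k ∩ {ω | ω (k + 1) = o}) ≤ ENNReal.ofReal (1 - 1 / (8 * K ^ 2)) := by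
    calc ∑ k ∈ Finset.range n, R.walkLaw o (avoids o k ∩ {ω | ω (k + 1) = o})
        ≤ ∑ k ∈ Finset.range (n + 1), R.walkLaw o (avoids o k ∩ {ω | ω (k + 1) = o}) :=
          Finset.sum_le_sum_of_subset (Finset.range_mono (Nat.le_succ n))
      _ = ENNReal.ofReal (∑ k ∈ Finset.range (n + 1), firstReturn R o k) := by
          rw [ENNReal.ofReal_sum_of_nonneg (f := firstReturn R o) fun _ _ => measureReal_nonneg]
          exact Finset.sum_congr rfl fun k _ => (ofReal_measureReal (measure_ne_top _ _)).symm
      _ ≤ _ := ENNReal.ofReal_le_ofReal (h.sum_firstReturn_le o hK hdeg n)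
  calc R.returnProb o
      ≤ R.walkLaw o (⋃ n, avoids o n ∩ {ω | ω (n + 1) = o}) :=
        measure_mono (setOf_exists_return_subset o)
    _ ≤ ∑' n, R.walkLaw o (avoids o n ∩ {ω | ω (n + 1) = o}) := measure_iUnion_le _
    _ ≤ ENNReal.ofReal (1 - 1 / (8 * K ^ 2)) := ENNReal.tsum_le_of_sum_range_le hpartial
    _ < 1 := by
        rw [ENNReal.ofReal_lt_one]
        exact sub_lt_self 1 (by positivity)

end

theorem theorem1p3 {V : Type*} (G : PlanarMap V)
    (hfin : ∀ v : V, (G.graph.neighborSet v).Finite)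
    (hna : G.graph.IsNonamenable) :
    G.IsUKTransient := by
  classical
  let : G.roundabout.LocallyFinite := fun d =>
    (Set.finite_of_encard_le_coe (PlanarMap.encard_neighborSet_roundabout_le (hfin d.fst))).fintype
  obtain ⟨K, hK, hiso⟩ := G.exists_isEdgeIsoperimetric_roundabout hfin hna
  exact hiso.isTransient hK fun d =>
    (G.roundabout.degree_pos_iff_exists_adj d).2 ⟨d.symm, Or.inl rfl⟩
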